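/- Write $\mathcal B(t,r)=\{x\in\mathbb R^t:\|x\|_2\le r\}$. Let $d_0\ge 0$, $d\ge1$ be integers and $B_0,B,R_{\max},L\ge0$ reals with $B+R_{\max}>0$, and let $\gamma\in[0,1]$. Let $\mathcal S,\mathcal A\subseteq\mathcal B(d_0,B_0)$ be a set of states and a set of actions, and let $\phi:\mathcal B(d_0,B_0)^2\to\mathbb R^d$ be a feature map with $\|\phi(s,a)\|_2\le B$ for all $(s,a)$ that is $L$-Lipschitz for the Euclidean metrics, i.e. $\|\phi(s_1,a_1)-\phi(s_2,a_2)\|_2\le L\sqrt{\|s_1-s_2\|_2^2+\|a_1-a_2\|_2^2}$. For $v\in\mathbb R^d$ let $f_v(s,a)=v^{\mathsf T}\phi(s,a)$, and let $\mathcal Q_0=\{f_v:\|v\|_2\le1\}$. For a nonempty finite dataset $D$ of tuples $(s,a,r,s')\in\mathcal B(d_0,B_0)\times\mathcal B(d_0,B_0)\times[0,R_{\max}]\times\mathcal B(d_0,B_0)$, a predictor $f$ and $\lambda\in\mathbb R$ let $$\hat L(D,f,\lambda)=\mathbb E_{(s,a,r,s')\leftarrow D}\Big[\big(f(s,a)-\lambda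 r-\gamma\max_{a'\in\mathcal A}f(s',a')\big)^2\Big],\qquad L_{\mathrm{Bell}}(D,f)=\hat L(D,f,1)$$ (the expectation is the average over $D$, and the maximum is a supremum if it is not attained), and for datasets $D,D'$ put $\hat L^{\mathrm{err}}(D,D',f,\lambda)=(\hat L(D,f,\lambda)-\hat L(D',f,\lambda))^2$ and $L^{\mathrm{err}}_{\mathrm{Bell}}(D,D',f)=(L_{\mathrm{Bell}}(D,f)-L_{\mathrm{Bell}}(D',f))^2$. Let $p$ be the pseudo-dimension, assumed finite, of the class of functions $(s,a,r,s')\mapsto\hat L(\{(s,a,r,s')\},f,\lambda)$ on $\mathcal B(d_0,B_0)\times\mathcal B(d_0,B_0)\times[0,R_{\max}]\times\mathcal B(d_0,B_0)$, where $f\in\mathcal Q_0$ and $\lambda\in[-1,1]$. (The pseudo-dimension of a class $\mathcal U$ of real functions is the largest size of a finite set $T$ for which there are thresholds $(t_x)_{x\in T}$ such that for every $b\subseteq T$ some $u\in\mathcal U$ satisfies $u(x)\ge t_x\iff x\in b$ for all $x\in T$.) There are absolute constants $c_1,c_2,c_3>0$ such that, for all data as above, the following holds for every nonempty finite training dataset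 $D_{\mathrm{train}}$ of tuples in $\mathcal S\times\mathcal A\times[0,R_{\max}]\times\mathcal S$ and all $\Delta>0$, $\delta>0$. Let $\nu=\Delta/(B+R_{\max})^4$, let $\bar\nu=\min(\nu,\tfrac12)$ and $\bar\delta=\min(\delta,\tfrac12)$, and let $k$ be any natural number with $$k\ \ge\ (1/\bar\nu)^{c_1 d\log d}\cdot c_2\,p\,\Big(\log(1/\bar\nu)+\max\big(0,\log\tfrac{B_0L}{B+R_{\max}}\big)\Big)\log(1/\bar\delta)$$ (with $\max(0,\log 0)=0$). Let $(v_1,\lambda_1),\dots,(v_k,\lambda_k)$ be independent, each with $v_j\sim N(0,1)^d$ and $\lambda_j\sim N(0,1)$ independent. Then, with probability at least $1-\delta$, every nonempty finite synthetic dataset $D_{\mathrm{syn}}$ of tuples in $\mathcal B(d_0,B_0)\times\mathcal B(d_0,B_0)\times[0,R_{\max}]\times\mathcal B(d_0,B_0)$ with $$\sum_{j=1}^k\hat L^{\mathrm{err}}(D_{\mathrm{train}},D_{\mathrm{syn}},f_{v_j},\lambda_j)\le\Delta/c_3$$ satisfies $L^{\mathrm{err}}_{\mathrm{Bell}}(D_{\mathrm{train}},D_{\mathrm{syn}},f)\le\Delta$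 for all $f\in\mathcal Q_0$. -/

import Mathlib

open MeasureTheory ProbabilityTheory

namespace OfflineRL

/-- Euclidean space of dimension `d`. -/
abbrev Vec (d : ℕ) : Type := EuclideanSpace ℝ (Fin d)

/-- A tuple (state, action, reward, next state). -/
structure Transition (d₀ : ℕ) where
  state : Vec d₀
  action : Vec d₀
  reward : ℝ
  next : Vec d₀

/-- The tuple lies in `S × A × [0, Rmax] × S`. -/
def Transition.MemTrain {d₀ : ℕ} (S A : Set (Vec d₀)) (Rmax : ℝ) (z : Transition d₀) : Prop :=
  z.state ∈ S ∧ z.action ∈ A ∧ z.reward ∈ Set.Icc 0 Rmax ∧ z.next ∈ S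

/-- The tuple lies in `𝓑(d₀, B₀) × 𝓑(d₀, B₀) × [0, Rmax] × 𝓑(d₀, B₀)`. -/
def Transition.MemSyn {d₀ : ℕ} (B₀ Rmax : ℝ) (z : Transition d₀) : Prop :=
  ‖z.state‖ ≤ B₀ ∧ ‖z.action‖ ≤ B₀ ∧ z.reward ∈ Set.Icc 0 Rmax ∧ ‖z.next‖ ≤ B₀

/-- `φ`, restricted to `𝓑(d₀, B₀)²`, takes values of norm at most `B`. -/
def FeatureBounded {d₀ d : ℕ} (φ : Vec d₀ → Vec d₀ → Vec d) (B₀ B : ℝ) : Prop :=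
  ∀ s a, ‖s‖ ≤ B₀ → ‖a‖ ≤ B₀ → ‖φ s a‖ ≤ B

/-- `φ`, restricted to `𝓑(d₀, B₀)²`, is `L`-Lipschitz for the Euclidean metrics. -/
def FeatureLipschitz {d₀ d : ℕ} (φ : Vec d₀ → Vec d₀ → Vec d) (B₀ L : ℝ) : Prop :=
  ∀ s₁ a₁ s₂ a₂, ‖s₁‖ ≤ B₀ → ‖a₁‖ ≤ B₀ → ‖s₂‖ ≤ B₀ → ‖a₂‖ ≤ B₀ →
    ‖φ s₁ a₁ - φ s₂ a₂‖ ≤ L * Real.sqrt (‖s₁ - s₂‖ ^ 2 + ‖a₁ - a₂‖ ^ 2)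

/-- The linear action-value predictor `f(s, a) = vᵀ φ(s, a)`. -/
noncomputable def linPred {d₀ d : ℕ} (φ : Vec d₀ → Vec d₀ → Vec d) (v : Vec d) :
    Vec d₀ → Vec d₀ → ℝ :=
  fun s a => inner ℝ v (φ s a)

/-- The class of linear predictors with weight vector of norm at most one. -/
def Q₀ {d₀ d : ℕ} (φ : Vec d₀ → Vec d₀ → Vec d) : Set (Vec d₀ → Vec d₀ → ℝ) :=
  {f | ∃ v : Vec d, ‖v‖ ≤ 1 ∧ f = linPred φ v}

/-- The Bellman loss: the average over the dataset of
`(f(s, a) - r - γ max_{a' ∈ A} f(s', a'))²`. -/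
noncomputable def bellmanLoss {d₀ n : ℕ} (γ : ℝ) (A : Set (Vec d₀))
    (D : Fin n → Transition d₀) (f : Vec d₀ → Vec d₀ → ℝ) : ℝ :=
  (1 / (n : ℝ)) * ∑ i, (f (D i).state (D i).action - (D i).reward
    - γ * ⨆ a' : A, f (D i).next a') ^ 2

/-- The modified Bellman loss, in which the reward is scaled by `lam`. -/
noncomputable def modBellmanLoss {d₀ n : ℕ} (γ : ℝ) (A : Set (Vec d₀))
    (D : Fin n → Transition d₀) (f : Vec d₀ → Vec d₀ → ℝ) (lam : ℝ) : ℝ :=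
  (1 / (n : ℝ)) * ∑ i, (f (D i).state (D i).action - lam * (D i).reward
    - γ * ⨆ a' : A, f (D i).next a') ^ 2

/-- The squared gap of the Bellman losses of two datasets. -/
noncomputable def bellmanErr {d₀ n m : ℕ} (γ : ℝ) (A : Set (Vec d₀))
    (D : Fin n → Transition d₀) (D' : Fin m → Transition d₀)
    (f : Vec d₀ → Vec d₀ → ℝ) : ℝ :=
  (bellmanLoss γ A D f - bellmanLoss γ A D' f) ^ 2

/-- The squared gap of the modified Bellman losses of two datasets. -/
noncomputable def modBellmanErr {d₀ n m : ℕ} (γ : ℝ) (A : Set (Vec d₀))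
    (D : Fin n → Transition d₀) (D' : Fin m → Transition d₀)
    (f : Vec d₀ → Vec d₀ → ℝ) (lam : ℝ) : ℝ :=
  (modBellmanLoss γ A D f lam - modBellmanLoss γ A D' f lam) ^ 2

/-- `T` is pseudo-shattered by `F`: there are thresholds `t` such that every subset of `T` is
cut out, as the set of points where the value is at least the threshold, by some member of `F`. -/
def PseudoShattered {X : Type*} (F : Set (X → ℝ)) (T : Finset X) : Prop :=
  ∃ t : X → ℝ, ∀ b : Set X, ∃ f ∈ F, ∀ x ∈ T, t x ≤ f x ↔ x ∈ b

/-- The pseudo-dimension: the largest size of a pseudo-shattered finite set (`⊤` if unbounded). -/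
noncomputable def pseudoDim {X : Type*} (F : Set (X → ℝ)) : ℕ∞ :=
  ⨆ T : Finset X, ⨆ _ : PseudoShattered F T, (T.card : ℕ∞)

/-- The class of modified Bellman losses of single points, over `f ∈ Q₀` and `lam ∈ [-1, 1]`, as
functions on `𝓑(d₀, B₀) × 𝓑(d₀, B₀) × [0, Rmax] × 𝓑(d₀, B₀)`. -/
def singlePointClass {d₀ d : ℕ} (φ : Vec d₀ → Vec d₀ → Vec d) (γ : ℝ) (A : Set (Vec d₀))
    (B₀ Rmax : ℝ) : Set ({z : Transition d₀ // z.MemSyn B₀ Rmax} → ℝ) :=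
  {u | ∃ f ∈ Q₀ φ, ∃ lam ∈ Set.Icc (-1 : ℝ) 1,
    u = fun z => modBellmanLoss γ A (fun _ : Fin 1 => z.1) f lam}

/-- The law of `(r, lam)` with `r ∼ N(0, 1)^d` and `lam ∼ N(0, 1)` independent; the pair
represents `(f, lam)` with `f = linPred φ r`. -/
noncomputable def H (d : ℕ) : Measure (Vec d × ℝ) :=
  (stdGaussian (Vec d)).prod (gaussianReal 0 1)

/-- The law of `k` independent samples from `H d`. -/
noncomputable def iidH (d k : ℕ) : Measure (Fin k → Vec d × ℝ) :=
  Measure.pi fun _ => H d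

/-- The number of samples
`(1/ν)^(c₁ d log d) · c₂ p (log (1/ν) + log (B₀ L / (B + Rmax))) log (1/δ)`, where `1/ν` and `1/δ`
are replaced by `2` when smaller than `2`, and a negative value of `log (B₀ L / (B + Rmax))`
is replaced by `0`. -/
noncomputable def sampleBound (c₁ c₂ : ℝ) (d p : ℕ) (ν B₀ L B Rmax δ : ℝ) : ℝ :=
  (max 2 (1 / ν)) ^ (c₁ * (d * Real.log d)) *
    (c₂ * (p * (Real.log (max 2 (1 / ν)) + Real.log (max 1 (B₀ * L / (B + Rmax))))) *
      Real.log (max 2 (1 / δ)))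

end OfflineRL

/-! The loss gap of the two datasets at `(v, lam)` depends continuously on `(v, lam)`, so it
suffices that the samples visit finitely many prescribed boxes. That event involves neither dataset,
so no union bound over synthetic datasets arises. The hypothesis on the sum bounds the gap at every
sample by `√Δ / 486`, since all summands are squares.

For `d ≥ 2`, cut `[-1, 1]^d` into cells of side about `1 / (d x)`, where `x = max 2 (1 / ν)`, and
let `lam` lie just above `1`. A cell has Gaussian mass at least a power `d + 1` of its side
(`exists_le_H_sampleBox`), so about `(C d x) ^ (2 d + 2)` samples, up to the factor in `δ`, hit all
cells (`exists_event_forall_hit`); this is below `x ^ (c₁ d log d)` by `pow_le_rpow_mul_log`. Every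
`(v, 1)` with `‖v‖ ≤ 1` then has a sample nearby, and `abs_lossGap_sub_le` transfers the bound.

For `d = 1` the exponent `d log d` is zero, so the number of boxes may not grow with `1 / ν`. Here
the supremum over actions is positively homogeneous in the weight, so for each sign of `v` the gap
is a quadratic form in `(v, lam)`. Three samples with separated ratios `v / lam` control it by
interpolation (`abs_lossGap_one_le`), and six boxes suffice.

If `p = 0` the bound may permit no samples at all, but then all Bellman residuals with `‖v‖ ≤ 1`
vanish (`residual_eq_zero_of_pseudoDim_eq_zero`). -/

namespace OfflineRL

/-! ### Gaussian mass of boxes -/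

/-- The standard Gaussian gives every interval inside `[-9, 9]` mass at least a fixed multiple
of its length. -/
lemma exists_le_gaussianReal_Icc : ∃ c : ℝ, 0 < c ∧ c ≤ 1 ∧ ∀ a b : ℝ, -9 ≤ a → b ≤ 9 →
    ENNReal.ofReal (c * (b - a)) ≤ gaussianReal 0 1 (Set.Icc a b) := by
  have hpos : 0 < gaussianPDFReal 0 1 9 := gaussianPDFReal_pos 0 1 9 one_ne_zero
  -- On `[-9, 9]` the density is smallest at the ends; the minimum with `1` only provides `c ≤ 1`.
  refine ⟨min 1 (gaussianPDFReal 0 1 9), by positivity, min_le_left _ _, fun a b ha hb => ?_⟩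
  rw [gaussianReal_apply 0 one_ne_zero]
  calc ENNReal.ofReal (min 1 (gaussianPDFReal 0 1 9) * (b - a))
      = ∫⁻ _ in Set.Icc a b, ENNReal.ofReal (min 1 (gaussianPDFReal 0 1 9)) := by
        rw [setLIntegral_const, Real.volume_Icc, ENNReal.ofReal_mul (by positivity)]
    _ ≤ _ := by
        refine setLIntegral_mono' measurableSet_Icc fun x hx => ?_
        refine ENNReal.ofReal_le_ofReal ((min_le_right _ _).trans ?_)
        simp only [gaussianPDFReal, NNReal.coe_one]
        gcongr ?_ * Real.exp (?_ / _)
        have h1 : -9 ≤ x := ha.trans hx.1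
        have h2 : x ≤ 9 := hx.2.trans hb
        nlinarith

/-- The box of samples `(v, lam)` with `l i ≤ v i ≤ u i` for all `i` and `a ≤ lam ≤ b`. -/
def sampleBox {d : ℕ} (l u : Fin d → ℝ) (a b : ℝ) : Set (Vec d × ℝ) :=
  {w | (∀ i, w.1 i ∈ Set.Icc (l i) (u i)) ∧ w.2 ∈ Set.Icc a b}

lemma sampleBox_eq_prod {d : ℕ} (l u : Fin d → ℝ) (a b : ℝ) :
    sampleBox l u a b =
      (WithLp.ofLp ⁻¹' Set.univ.pi fun i => Set.Icc (l i) (u i)) ×ˢ Set.Icc a b := by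
  ext w
  simp only [sampleBox, Set.mem_ofPred_eq, Set.mem_prod, Set.mem_preimage, Set.mem_univ_pi]

lemma measurableSet_sampleBox {d : ℕ} (l u : Fin d → ℝ) (a b : ℝ) :
    MeasurableSet (sampleBox l u a b) := by
  rw [sampleBox_eq_prod]
  refine MeasurableSet.prod ?_ measurableSet_Icc
  exact (MeasurableSet.univ_pi fun _ => measurableSet_Icc).preimage (by fun_prop)

lemma H_sampleBox {d : ℕ} (l u : Fin d → ℝ) (a b : ℝ) :
    H d (sampleBox l u a b) =
      (∏ i, gaussianReal 0 1 (Set.Icc (l i) (u i))) * gaussianReal 0 1 (Set.Icc a b) := by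
  rw [sampleBox_eq_prod, H, Measure.prod_prod, ← map_pi_eq_stdGaussian, Measure.map_apply,
    ← Measure.pi_pi]
  · rfl
  · fun_prop
  · exact (MeasurableSet.univ_pi fun _ => measurableSet_Icc).preimage (by fun_prop)

instance (d : ℕ) : IsProbabilityMeasure (H d) := by unfold H; infer_instance

instance (d k : ℕ) : IsProbabilityMeasure (iidH d k) := by unfold iidH; infer_instance

lemma exists_le_H_sampleBox : ∃ c : ℝ, 0 < c ∧ c ≤ 1 ∧
    ∀ (d : ℕ) (l u : Fin d → ℝ) (a b s : ℝ), 0 ≤ s → (∀ i, -9 ≤ l i) → (∀ i, u i ≤ 9) →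
      -9 ≤ a → b ≤ 9 → (∀ i, l i + s ≤ u i) → a + s ≤ b →
      ENNReal.ofReal ((c * s) ^ (d + 1)) ≤ H d (sampleBox l u a b) := by
  obtain ⟨c, hc, hc1, h⟩ := exists_le_gaussianReal_Icc
  refine ⟨c, hc, hc1, fun d l u a b s hs hl hu ha hb hlu hab => ?_⟩
  have key : ∀ x y : ℝ, -9 ≤ x → y ≤ 9 → x + s ≤ y →
      ENNReal.ofReal (c * s) ≤ gaussianReal 0 1 (Set.Icc x y) := fun x y hx hy hxy =>
    (ENNReal.ofReal_le_ofReal (by gcongr; linarith)).trans (h x y hx hy)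
  rw [H_sampleBox, pow_succ, ENNReal.ofReal_mul (by positivity), ENNReal.ofReal_pow (by positivity)]
  gcongr
  · calc ENNReal.ofReal (c * s) ^ d = ∏ _i : Fin d, ENNReal.ofReal (c * s) := by simp
      _ ≤ _ := Finset.prod_le_prod' fun i _ => key _ _ (hl i) (hu i) (hlu i)
  · exact key _ _ ha hb hab

/-! ### Hitting finitely many sets by independent samples -/

/-- If finitely many sets each have mass at least `q`, then sufficiently many independent samples
hit all of them with probability at least `1 - δ`. -/
lemma exists_event_forall_hit {Ω ι : Type*} [MeasurableSpace Ω] (μ : Measure Ω)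
    [IsProbabilityMeasure μ] [Fintype ι] [Nonempty ι] (C : ι → Set Ω)
    (hC : ∀ i, MeasurableSet (C i)) {q δ : ℝ} (hq : 0 < q)
    (hCq : ∀ i, ENNReal.ofReal q ≤ μ (C i)) (hδ : 0 < δ) (k : ℕ)
    (hk : 2 * Fintype.card ι / q * Real.log (max 2 (1 / δ)) ≤ k) :
    ∃ E : Set (Fin k → Ω), MeasurableSet E ∧
      ENNReal.ofReal (1 - δ) ≤ Measure.pi (fun _ => μ) E ∧
      ∀ ω ∈ E, ∀ i, ∃ j, ω j ∈ C i := by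
  set P : Measure (Fin k → Ω) := Measure.pi fun _ => μ
  let M : ι → Set (Fin k → Ω) := fun i => Set.univ.pi fun _ => (C i)ᶜ
  have hM : ∀ i, MeasurableSet (M i) := fun i => MeasurableSet.univ_pi fun _ => (hC i).compl
  have hMu : MeasurableSet (⋃ i, M i) := MeasurableSet.iUnion hM
  have hq1 : q ≤ 1 := by
    have := (hCq (Classical.arbitrary ι)).trans prob_le_one
    simpa using this
  have hPM : ∀ i, P (M i) ≤ ENNReal.ofReal (Real.exp (-(q * k))) := fun i => by
    have h1 : μ (C i)ᶜ ≤ ENNReal.ofReal (1 - q) := by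
      rw [prob_compl_eq_one_sub (hC i), ENNReal.ofReal_sub _ hq.le, ENNReal.ofReal_one]
      gcongr
      exact hCq i
    calc P (M i) = μ (C i)ᶜ ^ k := by simp [P, M, Measure.pi_pi]
      _ ≤ ENNReal.ofReal (1 - q) ^ k := by gcongr
      _ = ENNReal.ofReal ((1 - q) ^ k) := (ENNReal.ofReal_pow (by linarith) k).symm
      _ ≤ _ := by
        refine ENNReal.ofReal_le_ofReal ?_
        calc (1 - q) ^ k ≤ Real.exp (-q) ^ k :=
              pow_le_pow_left₀ (by linarith) (Real.one_sub_le_exp_neg q) k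
          _ = Real.exp (-(q * k)) := by rw [← Real.exp_nat_mul]; ring_nf
  set N : ℝ := (Fintype.card ι : ℝ) with hN
  have hN1 : 1 ≤ N := by
    have : 1 ≤ Fintype.card ι := Fintype.card_pos
    exact Nat.one_le_cast.2 this
  have hsum : N * Real.exp (-(q * k)) ≤ δ := by
    set y := max 2 (1 / δ) with hy
    have hy2 : 2 ≤ y := le_max_left _ _
    have hl : (1 : ℝ) / 2 ≤ Real.log y := by
      have := Real.log_le_log (by norm_num) hy2
      linarith [Real.log_two_gt_d9]
    have h1 : 2 * N * Real.log y ≤ q * k := by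
      have := mul_le_mul_of_nonneg_left hk hq.le
      calc 2 * N * Real.log y = q * (2 * N / q * Real.log y) := by field_simp
        _ ≤ _ := this
    -- From `log N ≤ N - 1` and `log y ≥ 1 / 2` one gets `log N + log y ≤ 2 N log y`, so the union
    -- bound `N exp (-q k)` is at most `1 / y ≤ δ`.
    have h2 : Real.log N + Real.log y ≤ q * k := by
      have := Real.log_le_sub_one_of_pos (by linarith : (0 : ℝ) < N)
      nlinarith
    have h3 : N * Real.exp (-(q * k)) ≤ 1 / y := by
      have h4 : Real.exp (-(q * k)) ≤ Real.exp (-(Real.log N + Real.log y)) := by gcongr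
      rw [Real.exp_neg (_ + _), Real.exp_add, Real.exp_log (by linarith),
        Real.exp_log (by linarith)] at h4
      calc N * Real.exp (-(q * k)) ≤ N * (N * y)⁻¹ := by gcongr
        _ = 1 / y := by
          have : N ≠ 0 := by linarith
          field_simp
    refine h3.trans ?_
    have : 1 / δ ≤ y := le_max_right _ _
    rw [div_le_iff₀ (by linarith)]
    rw [div_le_iff₀ hδ] at this
    linarith
  refine ⟨(⋃ i, M i)ᶜ, hMu.compl, ?_, fun ω hω i => ?_⟩
  · rw [prob_compl_eq_one_sub hMu, ENNReal.ofReal_sub _ hδ.le, ENNReal.ofReal_one]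
    gcongr
    calc P (⋃ i, M i) ≤ ∑ i, P (M i) := measure_iUnion_fintype_le _ _
      _ ≤ ∑ _i : ι, ENNReal.ofReal (Real.exp (-(q * k))) := Finset.sum_le_sum fun i _ => hPM i
      _ = ENNReal.ofReal (N * Real.exp (-(q * k))) := by
        rw [ENNReal.ofReal_mul (by positivity)]; simp [hN]
      _ ≤ _ := ENNReal.ofReal_le_ofReal hsum
  · by_contra! hcon
    exact hω (Set.mem_iUnion.2 ⟨i, fun j _ => hcon j⟩)


/-! ### Residuals, and Lipschitz dependence of the loss gap on `(v, lam)` -/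

/-- The modified Bellman residual of a single transition. -/
noncomputable def residual {d₀ d : ℕ} (φ : Vec d₀ → Vec d₀ → Vec d) (γ : ℝ) (A : Set (Vec d₀))
    (v : Vec d) (lam : ℝ) (z : Transition d₀) : ℝ :=
  linPred φ v z.state z.action - lam * z.reward - γ * ⨆ a' : A, linPred φ v z.next a'

lemma modBellmanLoss_linPred {d₀ d n : ℕ} (φ : Vec d₀ → Vec d₀ → Vec d) (γ : ℝ)
    (A : Set (Vec d₀)) (D : Fin n → Transition d₀) (v : Vec d) (lam : ℝ) :
    modBellmanLoss γ A D (linPred φ v) lam = (1 / (n : ℝ)) * ∑ i, residual φ γ A v lam (D i) ^ 2 :=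
  rfl

lemma bellmanLoss_eq {d₀ n : ℕ} (γ : ℝ) (A : Set (Vec d₀))
    (D : Fin n → Transition d₀) (f : Vec d₀ → Vec d₀ → ℝ) :
    bellmanLoss γ A D f = modBellmanLoss γ A D f 1 := by
  simp [bellmanLoss, modBellmanLoss]

/-- The gap of the modified Bellman losses of two datasets. -/
noncomputable def lossGap {d₀ d n m : ℕ} (φ : Vec d₀ → Vec d₀ → Vec d) (γ : ℝ) (A : Set (Vec d₀))
    (D : Fin n → Transition d₀) (D' : Fin m → Transition d₀) (v : Vec d) (lam : ℝ) : ℝ :=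
  modBellmanLoss γ A D (linPred φ v) lam - modBellmanLoss γ A D' (linPred φ v) lam

lemma bellmanErr_linPred {d₀ d n m : ℕ} (φ : Vec d₀ → Vec d₀ → Vec d) (γ : ℝ) (A : Set (Vec d₀))
    (D : Fin n → Transition d₀) (D' : Fin m → Transition d₀) (v : Vec d) :
    bellmanErr γ A D D' (linPred φ v) = lossGap φ γ A D D' v 1 ^ 2 := by
  simp [bellmanErr, lossGap, bellmanLoss_eq]

lemma abs_lossGap_le {d₀ d n m k : ℕ} {φ : Vec d₀ → Vec d₀ → Vec d} {γ : ℝ} {A : Set (Vec d₀)}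
    {D : Fin n → Transition d₀} {D' : Fin m → Transition d₀} {ω : Fin k → Vec d × ℝ} {Δ c : ℝ}
    (hc : 0 < c)
    (h : ∑ j, modBellmanErr γ A D D' (linPred φ (ω j).1) (ω j).2 ≤ Δ / c ^ 2) (j : Fin k) :
    |lossGap φ γ A D D' (ω j).1 (ω j).2| ≤ √Δ / c := by
  have h1 : lossGap φ γ A D D' (ω j).1 (ω j).2 ^ 2 ≤ Δ / c ^ 2 :=
    le_trans (Finset.single_le_sum
      (f := fun j => modBellmanErr γ A D D' (linPred φ (ω j).1) (ω j).2)
      (fun i _ => sq_nonneg _) (Finset.mem_univ j)) h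
  have := Real.abs_le_sqrt h1
  rwa [Real.sqrt_div' _ (by positivity), Real.sqrt_sq hc.le] at this

lemma abs_average_le {n : ℕ} (hn : 0 < n) (f : Fin n → ℝ) {C : ℝ} (h : ∀ i, |f i| ≤ C) :
    |(1 / (n : ℝ)) * ∑ i, f i| ≤ C := by
  have hn' : (0 : ℝ) < n := by exact_mod_cast hn
  rw [abs_mul, abs_of_pos (by positivity), one_div, inv_mul_le_iff₀ hn']
  calc |∑ i, f i| ≤ ∑ i, |f i| := Finset.abs_sum_le_sum_abs _ _
    _ ≤ ∑ _i : Fin n, C := Finset.sum_le_sum fun i _ => h i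
    _ = n * C := by simp

lemma abs_ciSup_sub_ciSup_le {ι : Type*} [Nonempty ι] {f g : ι → ℝ} {C : ℝ}
    (hf : BddAbove (Set.range f)) (hg : BddAbove (Set.range g)) (h : ∀ i, |f i - g i| ≤ C) :
    |(⨆ i, f i) - ⨆ i, g i| ≤ C := by
  rw [abs_sub_le_iff]
  constructor
  · rw [sub_le_iff_le_add]
    exact ciSup_le fun i => by linarith [le_ciSup hg i, (abs_sub_le_iff.1 (h i)).1]
  · rw [sub_le_iff_le_add]
    exact ciSup_le fun i => by linarith [le_ciSup hf i, (abs_sub_le_iff.1 (h i)).2]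

section Lipschitz

variable {d₀ d : ℕ} {φ : Vec d₀ → Vec d₀ → Vec d} {B₀ B Rmax γ : ℝ} {A : Set (Vec d₀)}

lemma residual_zero (z : Transition d₀) : residual φ γ A 0 0 z = 0 := by
  simp [residual, linPred]

/-- A supremum moves by no more than its terms do, so the current value and the discounted next
value contribute `B * ‖v - v'‖` each. -/
lemma abs_residual_sub_le (hγ : 0 ≤ γ) (hγ1 : γ ≤ 1)
    (hA : A ⊆ Metric.closedBall 0 B₀)
    (hne : A.Nonempty) (hφ : FeatureBounded φ B₀ B) {z : Transition d₀} (hz : z.MemSyn B₀ Rmax)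
    (v v' : Vec d) (lam lam' : ℝ) :
    |residual φ γ A v lam z - residual φ γ A v' lam' z|
      ≤ 2 * B * ‖v - v'‖ + Rmax * |lam - lam'| := by
  obtain ⟨hs, ha, ⟨hr0, hr⟩, hs'⟩ := hz
  have hin : ∀ (x : Vec d) s a, ‖s‖ ≤ B₀ → ‖a‖ ≤ B₀ → |linPred φ x s a| ≤ B * ‖x‖ :=
    fun x s a hs ha => (abs_real_inner_le_norm _ _).trans
      (by rw [mul_comm]; gcongr; exact hφ s a hs ha)
  have hsub : ∀ s a, ‖s‖ ≤ B₀ → ‖a‖ ≤ B₀ →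
      |linPred φ v s a - linPred φ v' s a| ≤ B * ‖v - v'‖ := fun s a hs ha => by
    have : linPred φ v s a - linPred φ v' s a = linPred φ (v - v') s a := by
      simp [linPred, inner_sub_left]
    rw [this]
    exact hin _ s a hs ha
  have hA' : ∀ a : A, ‖(a : Vec d₀)‖ ≤ B₀ := fun a => by simpa using hA a.2
  have : Nonempty A := hne.to_subtype
  have hbdd : ∀ x : Vec d, BddAbove (Set.range fun a' : A => linPred φ x z.next a') := fun x =>
    ⟨B * ‖x‖, by rintro _ ⟨a, rfl⟩; exact (le_abs_self _).trans (hin x _ _ hs' (hA' a))⟩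
  have hsup := abs_ciSup_sub_ciSup_le (hbdd v) (hbdd v') fun a => hsub z.next a hs' (hA' a)
  have h1 := hsub z.state z.action hs ha
  set X := (⨆ a' : A, linPred φ v z.next a') - ⨆ a' : A, linPred φ v' z.next a' with hX
  set Y := linPred φ v z.state z.action - linPred φ v' z.state z.action with hY
  have heq : residual φ γ A v lam z - residual φ γ A v' lam' z
      = Y - (lam - lam') * z.reward - γ * X := by
    simp only [residual, hX, hY]; ring
  have h2 : |γ * X| ≤ B * ‖v - v'‖ := by
    rw [abs_mul, abs_of_nonneg hγ]
    have := mul_le_mul hγ1 hsup (abs_nonneg _) zero_le_one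
    linarith
  have h3 : |(lam - lam') * z.reward| ≤ Rmax * |lam - lam'| := by
    rw [abs_mul, abs_of_nonneg hr0, mul_comm]
    gcongr
  rw [heq]
  have h4 := abs_sub (Y - (lam - lam') * z.reward) (γ * X)
  have h5 := abs_sub Y ((lam - lam') * z.reward)
  linarith

lemma abs_residual_sq_sub_le (hγ : 0 ≤ γ) (hγ1 : γ ≤ 1) (hB : 0 ≤ B) (hR : 0 ≤ Rmax)
    (hA : A ⊆ Metric.closedBall 0 B₀)
    (hne : A.Nonempty) (hφ : FeatureBounded φ B₀ B) {z : Transition d₀} (hz : z.MemSyn B₀ Rmax)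
    {v v' : Vec d} (hv : ‖v‖ ≤ 1) {lam' ε : ℝ} (hε : ε ≤ 1) (hvv' : ‖v - v'‖ ≤ ε)
    (hlam : |1 - lam'| ≤ ε) :
    |residual φ γ A v 1 z ^ 2 - residual φ γ A v' lam' z ^ 2| ≤ 12 * (B + Rmax) ^ 2 * ε := by
  have hε0 : 0 ≤ ε := (norm_nonneg _).trans hvv'
  have h1 : |residual φ γ A v 1 z - residual φ γ A v' lam' z| ≤ 2 * (B + Rmax) * ε := by
    refine (abs_residual_sub_le hγ hγ1 hA hne hφ hz v v' 1 lam').trans ?_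
    nlinarith [mul_le_mul_of_nonneg_left hvv' hB, mul_le_mul_of_nonneg_left hlam hR,
      mul_nonneg hR hε0]
  -- The residual vanishes at `(0, 0)`, so its Lipschitz bound also bounds its size.
  have h2 : |residual φ γ A v 1 z| ≤ 2 * (B + Rmax) := by
    have := abs_residual_sub_le hγ hγ1 hA hne hφ hz v 0 1 0
    rw [residual_zero] at this
    simp only [sub_zero, abs_one, mul_one] at this
    nlinarith
  set x := residual φ γ A v 1 z
  set y := residual φ γ A v' lam' z
  have h3 : |x + y| ≤ 6 * (B + Rmax) := by
    have : x + y = 2 * x - (x - y) := by ring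
    rw [this]
    have h4 := abs_sub (2 * x) (x - y)
    rw [abs_mul, abs_of_pos (two_pos : (0 : ℝ) < 2)] at h4
    nlinarith [mul_le_mul_of_nonneg_left hε (by positivity : 0 ≤ B + Rmax)]
  calc |x ^ 2 - y ^ 2| = |x + y| * |x - y| := by rw [← abs_mul]; ring_nf
    _ ≤ (6 * (B + Rmax)) * (2 * (B + Rmax) * ε) := by gcongr
    _ = _ := by ring

lemma abs_lossGap_sub_le (hγ : 0 ≤ γ) (hγ1 : γ ≤ 1) (hB : 0 ≤ B) (hR : 0 ≤ Rmax)
    (hA : A ⊆ Metric.closedBall 0 B₀) (hne : A.Nonempty) (hφ : FeatureBounded φ B₀ B)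
    {n m : ℕ} (hn : 0 < n) (hm : 0 < m) {D : Fin n → Transition d₀} {D' : Fin m → Transition d₀}
    (hD : ∀ i, (D i).MemSyn B₀ Rmax) (hD' : ∀ i, (D' i).MemSyn B₀ Rmax)
    {v v' : Vec d} (hv : ‖v‖ ≤ 1) {lam' ε : ℝ} (hε : ε ≤ 1) (hvv' : ‖v - v'‖ ≤ ε)
    (hlam : |1 - lam'| ≤ ε) :
    |lossGap φ γ A D D' v 1 - lossGap φ γ A D D' v' lam'| ≤ 24 * (B + Rmax) ^ 2 * ε := by
  have key : ∀ {n : ℕ} (_ : 0 < n) (D : Fin n → Transition d₀) (_ : ∀ i, (D i).MemSyn B₀ Rmax),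
      |modBellmanLoss γ A D (linPred φ v) 1 - modBellmanLoss γ A D (linPred φ v') lam'|
        ≤ 12 * (B + Rmax) ^ 2 * ε := fun hn D hD => by
    rw [modBellmanLoss_linPred, modBellmanLoss_linPred, ← mul_sub, ← Finset.sum_sub_distrib]
    exact abs_average_le hn _ fun i =>
      abs_residual_sq_sub_le hγ hγ1 hB hR hA hne hφ (hD i) hv hε hvv' hlam
  have h1 := key hn D hD
  have h2 := key hm D' hD'
  have h3 : lossGap φ γ A D D' v 1 - lossGap φ γ A D D' v' lam'
      = (modBellmanLoss γ A D (linPred φ v) 1 - modBellmanLoss γ A D (linPred φ v') lam')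
      - (modBellmanLoss γ A D' (linPred φ v) 1 - modBellmanLoss γ A D' (linPred φ v') lam') := by
    simp only [lossGap]; ring
  rw [h3]
  refine (abs_sub _ _).trans ?_
  linarith

end Lipschitz

/-! ### Pseudo-dimension zero -/

/-- A point with nonzero residual would be shattered: take its squared residual as threshold, which
`(v, 1)` attains and `(0, 0)`, having loss zero, does not. -/
lemma residual_eq_zero_of_pseudoDim_eq_zero {d₀ d : ℕ} {φ : Vec d₀ → Vec d₀ → Vec d}
    {B₀ Rmax γ : ℝ} {A : Set (Vec d₀)}
    (hp : pseudoDim (singlePointClass φ γ A B₀ Rmax) = 0) {v : Vec d} (hv : ‖v‖ ≤ 1)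
    {z : Transition d₀} (hz : z.MemSyn B₀ Rmax) : residual φ γ A v 1 z = 0 := by
  by_contra hne
  have hpos : 0 < residual φ γ A v 1 z ^ 2 := by positivity
  have hsh : PseudoShattered (singlePointClass φ γ A B₀ Rmax) {⟨z, hz⟩} := by
    refine ⟨fun _ => residual φ γ A v 1 z ^ 2, fun b => ?_⟩
    by_cases hb : (⟨z, hz⟩ : {z : Transition d₀ // z.MemSyn B₀ Rmax}) ∈ b
    · refine ⟨_, ⟨linPred φ v, ⟨v, hv, rfl⟩, 1, by norm_num, rfl⟩, fun x hx => ?_⟩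
      obtain rfl := Finset.mem_singleton.1 hx
      simp [hb, modBellmanLoss_linPred]
    · refine ⟨_, ⟨linPred φ 0, ⟨0, by simp, rfl⟩, 0, by norm_num, rfl⟩, fun x hx => ?_⟩
      obtain rfl := Finset.mem_singleton.1 hx
      simp [hb, modBellmanLoss_linPred, residual_zero, hne]
  have h1 : ((Finset.card {(⟨z, hz⟩ : {z : Transition d₀ // z.MemSyn B₀ Rmax})} : ℕ) : ℕ∞)
      ≤ pseudoDim (singlePointClass φ γ A B₀ Rmax) :=
    le_iSup₂_of_le (f := fun (T : Finset {z : Transition d₀ // z.MemSyn B₀ Rmax})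
      (_ : PseudoShattered (singlePointClass φ γ A B₀ Rmax) T) => (T.card : ℕ∞)) _ hsh le_rfl
  rw [hp] at h1
  simp at h1


/-! ### Dimension one: the loss gap as a quadratic form -/

lemma linPred_one {d₀ : ℕ} (φ : Vec d₀ → Vec d₀ → Vec 1) (v : Vec 1) (s a : Vec d₀) :
    linPred φ v s a = v 0 * φ s a 0 := by
  simp [linPred, PiLp.inner_apply, mul_comm]

lemma linPred_neg_neg {d₀ d : ℕ} (φ : Vec d₀ → Vec d₀ → Vec d) (v : Vec d) :
    linPred (fun s a => -φ s a) (-v) = linPred φ v := by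
  ext s a
  simp [linPred]

lemma lossGap_neg_neg {d₀ d n m : ℕ} (φ : Vec d₀ → Vec d₀ → Vec d) (γ : ℝ) (A : Set (Vec d₀))
    (D : Fin n → Transition d₀) (D' : Fin m → Transition d₀) (v : Vec d) (lam : ℝ) :
    lossGap (fun s a => -φ s a) γ A D D' (-v) lam = lossGap φ γ A D D' v lam := by
  simp only [lossGap, linPred_neg_neg]

/-- For one-dimensional features and nonnegative weights, the residual is linear. -/
lemma residual_one {d₀ : ℕ} (φ : Vec d₀ → Vec d₀ → Vec 1) (γ : ℝ) (A : Set (Vec d₀))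
    {v : Vec 1} (hv : 0 ≤ v 0) (lam : ℝ) (z : Transition d₀) :
    residual φ γ A v lam z =
      v 0 * (φ z.state z.action 0 - γ * ⨆ a' : A, φ z.next a' 0) - lam * z.reward := by
  simp only [residual, linPred_one]
  rw [← Real.mul_iSup_of_nonneg hv]
  ring

lemma exists_modBellmanLoss_eq_quadratic {d₀ n : ℕ} (φ : Vec d₀ → Vec d₀ → Vec 1) (γ : ℝ)
    (A : Set (Vec d₀)) (D : Fin n → Transition d₀) :
    ∃ α β ρ : ℝ, ∀ (v : Vec 1) (lam : ℝ), 0 ≤ v 0 →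
      modBellmanLoss γ A D (linPred φ v) lam
        = α * v 0 ^ 2 + β * (v 0 * lam) + ρ * lam ^ 2 := by
  let x : Transition d₀ → ℝ := fun z => φ z.state z.action 0 - γ * ⨆ a' : A, φ z.next a' 0
  refine ⟨1 / n * ∑ i, x (D i) ^ 2, 1 / n * ∑ i, -2 * x (D i) * (D i).reward,
    1 / n * ∑ i, (D i).reward ^ 2, fun v lam hv => ?_⟩
  rw [modBellmanLoss_linPred, mul_assoc, mul_assoc, mul_assoc, Finset.sum_mul, Finset.sum_mul,
    Finset.sum_mul, ← mul_add, ← mul_add, ← Finset.sum_add_distrib, ← Finset.sum_add_distrib]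
  congr 1
  refine Finset.sum_congr rfl fun i _ => ?_
  rw [residual_one φ γ A hv]
  simp only [x]
  ring

lemma exists_lossGap_eq_quadratic {d₀ n m : ℕ} (φ : Vec d₀ → Vec d₀ → Vec 1) (γ : ℝ)
    (A : Set (Vec d₀)) (D : Fin n → Transition d₀) (D' : Fin m → Transition d₀) :
    ∃ α β ρ : ℝ, ∀ (v : Vec 1) (lam : ℝ), 0 ≤ v 0 →
      lossGap φ γ A D D' v lam = α * v 0 ^ 2 + β * (v 0 * lam) + ρ * lam ^ 2 := by
  obtain ⟨α, β, ρ, h⟩ := exists_modBellmanLoss_eq_quadratic φ γ A D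
  obtain ⟨α', β', ρ', h'⟩ := exists_modBellmanLoss_eq_quadratic φ γ A D'
  refine ⟨α - α', β - β', ρ - ρ', fun v lam hv => ?_⟩
  rw [lossGap, h v lam hv, h' v lam hv]
  ring

/-- Bounds one term of a Lagrange interpolation formula; `162 = 9 * 9 / (1 / 2)`. -/
lemma abs_mul_mul_div_le {K y a b p q : ℝ} (hy : |y| ≤ K) (ha : |a| ≤ 9) (hb : |b| ≤ 9)
    (hp : 1 / 2 ≤ |p|) (hq : 1 ≤ |q|) : |y * (a * b / (p * q))| ≤ 162 * K := by
  have hK : 0 ≤ K := (abs_nonneg y).trans hy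
  rw [abs_mul, abs_div, abs_mul, abs_mul]
  have h1 : |a| * |b| / (|p| * |q|) ≤ 162 := by
    have h2 : 1 / 2 * 1 ≤ |p| * |q| := by gcongr
    have h3 : |a| * |b| ≤ 9 * 9 := by gcongr
    rw [div_le_iff₀ (by linarith)]
    linarith
  calc |y| * (|a| * |b| / (|p| * |q|)) ≤ K * 162 := by gcongr
    _ = 162 * K := mul_comm _ _

/-- A quadratic polynomial that is small at three separated points is small on `[0, 1]`. -/
lemma abs_quadratic_le_of_three {α β ρ K t₁ t₂ t₃ t : ℝ} (ht₁ : t₁ ∈ Set.Icc (0 : ℝ) (1 / 2))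
    (ht₂ : t₂ ∈ Set.Icc (1 : ℝ) 3) (ht₃ : t₃ ∈ Set.Icc (4 : ℝ) 9) (ht : t ∈ Set.Icc (0 : ℝ) 1)
    (h₁ : |α * t₁ ^ 2 + β * t₁ + ρ| ≤ K) (h₂ : |α * t₂ ^ 2 + β * t₂ + ρ| ≤ K)
    (h₃ : |α * t₃ ^ 2 + β * t₃ + ρ| ≤ K) : |α * t ^ 2 + β * t + ρ| ≤ 486 * K := by
  obtain ⟨ha, ha'⟩ := ht₁
  obtain ⟨hb, hb'⟩ := ht₂
  obtain ⟨hc, hc'⟩ := ht₃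
  obtain ⟨hd, hd'⟩ := ht
  have h12 : t₂ - t₁ ≠ 0 := by linarith
  have h13 : t₃ - t₁ ≠ 0 := by linarith
  have h23 : t₃ - t₂ ≠ 0 := by linarith
  -- Lagrange interpolation at `t₁, t₂, t₃`. Each of the three terms is at most `162 * K`, whence
  -- `486`.
  have heq : α * t ^ 2 + β * t + ρ =
      (α * t₁ ^ 2 + β * t₁ + ρ) * ((t₂ - t) * (t₃ - t) / ((t₂ - t₁) * (t₃ - t₁)))
      + (α * t₂ ^ 2 + β * t₂ + ρ) * ((t - t₁) * (t₃ - t) / ((t₂ - t₁) * (t₃ - t₂)))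
      + (α * t₃ ^ 2 + β * t₃ + ρ) * ((t - t₁) * (t - t₂) / ((t₃ - t₁) * (t₃ - t₂))) := by
    field_simp
    ring
  rw [heq]
  refine (abs_add_three _ _ _).trans ?_
  have hle : ∀ x : ℝ, -9 ≤ x → x ≤ 9 → |x| ≤ 9 := fun x h h' => abs_le.2 ⟨h, h'⟩
  have e₁ := abs_mul_mul_div_le (a := t₂ - t) (b := t₃ - t) (p := t₂ - t₁) (q := t₃ - t₁) h₁
    (hle _ (by linarith) (by linarith)) (hle _ (by linarith) (by linarith))
    ((by linarith : 1 / 2 ≤ t₂ - t₁).trans (le_abs_self _))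
    ((by linarith : 1 ≤ t₃ - t₁).trans (le_abs_self _))
  have e₂ := abs_mul_mul_div_le (a := t - t₁) (b := t₃ - t) (p := t₂ - t₁) (q := t₃ - t₂) h₂
    (hle _ (by linarith) (by linarith)) (hle _ (by linarith) (by linarith))
    ((by linarith : 1 / 2 ≤ t₂ - t₁).trans (le_abs_self _))
    ((by linarith : 1 ≤ t₃ - t₂).trans (le_abs_self _))
  have e₃ := abs_mul_mul_div_le (a := t - t₁) (b := t - t₂) (p := t₃ - t₁) (q := t₃ - t₂) h₃
    (hle _ (by linarith) (by linarith)) (hle _ (by linarith) (by linarith))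
    ((by linarith : 1 / 2 ≤ t₃ - t₁).trans (le_abs_self _))
    ((by linarith : 1 ≤ t₃ - t₂).trans (le_abs_self _))
  linarith

/-- The form is homogeneous of degree two, and dividing it by `lam ^ 2 ≥ 1` only shrinks it. This
reduces two variables to the ratio `x / lam`. -/
lemma abs_quadratic_div_le {α β ρ K x lam : ℝ} (hlam : 1 ≤ lam)
    (h : |α * x ^ 2 + β * (x * lam) + ρ * lam ^ 2| ≤ K) :
    |α * (x / lam) ^ 2 + β * (x / lam) + ρ| ≤ K := by
  have h0 : 0 < lam := by linarith
  have heq : α * x ^ 2 + β * (x * lam) + ρ * lam ^ 2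
      = (α * (x / lam) ^ 2 + β * (x / lam) + ρ) * lam ^ 2 := by field_simp
  rw [heq, abs_mul, abs_of_nonneg (sq_nonneg lam)] at h
  refine le_trans (le_mul_of_one_le_right (abs_nonneg _) ?_) h
  nlinarith

/-- The lower ends of the intervals from which the weights are taken in dimension one. -/
noncomputable def nodeLower : Fin 3 → ℝ := ![0, 2, 8]

/-- The upper ends of the intervals from which the weights are taken in dimension one. -/
noncomputable def nodeUpper : Fin 3 → ℝ := ![1 / 2, 3, 9]

lemma abs_lossGap_one_le_of_nonneg {d₀ n m : ℕ} (φ : Vec d₀ → Vec d₀ → Vec 1) (γ : ℝ)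
    (A : Set (Vec d₀)) (D : Fin n → Transition d₀) (D' : Fin m → Transition d₀) {K : ℝ}
    (h : ∀ i, ∃ (x : Vec 1) (lam : ℝ), x 0 ∈ Set.Icc (nodeLower i) (nodeUpper i) ∧
      lam ∈ Set.Icc (1 : ℝ) 2 ∧ |lossGap φ γ A D D' x lam| ≤ K)
    {v : Vec 1} (hv : v 0 ∈ Set.Icc (0 : ℝ) 1) : |lossGap φ γ A D D' v 1| ≤ 486 * K := by
  obtain ⟨α, β, ρ, hq⟩ := exists_lossGap_eq_quadratic φ γ A D D'
  obtain ⟨x₁, l₁, hx₁, hl₁, h₁⟩ := h 0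
  obtain ⟨x₂, l₂, hx₂, hl₂, h₂⟩ := h 1
  obtain ⟨x₃, l₃, hx₃, hl₃, h₃⟩ := h 2
  simp only [nodeLower, nodeUpper, Matrix.cons_val, Set.mem_Icc] at hx₁ hx₂ hx₃ hl₁ hl₂ hl₃
  rw [hq _ _ (by linarith)] at h₁ h₂ h₃
  rw [hq _ _ hv.1]
  -- Since `lam` ranges over `[1, 2]`, the node intervals give ratios in `[0, 1/2]`, `[1, 3]` and
  -- `[4, 9]`, which stay separated.
  have key := abs_quadratic_le_of_three (t₁ := x₁ 0 / l₁) (t₂ := x₂ 0 / l₂) (t₃ := x₃ 0 / l₃)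
    ⟨div_nonneg hx₁.1 (by linarith), by rw [div_le_iff₀ (by linarith)]; linarith⟩
    ⟨by rw [le_div_iff₀ (by linarith)]; linarith, by rw [div_le_iff₀ (by linarith)]; linarith⟩
    ⟨by rw [le_div_iff₀ (by linarith)]; linarith, by rw [div_le_iff₀ (by linarith)]; linarith⟩
    hv (abs_quadratic_div_le hl₁.1 h₁) (abs_quadratic_div_le hl₂.1 h₂)
    (abs_quadratic_div_le hl₃.1 h₃)
  simpa using key

/-- The boxes of samples that determine the loss gap in dimension one: three for either sign of
the weight. -/
noncomputable def nodeBox (i : Bool × Fin 3) : Set (Vec 1 × ℝ) :=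
  sampleBox (fun _ => if i.1 then nodeLower i.2 else -nodeUpper i.2)
    (fun _ => if i.1 then nodeUpper i.2 else -nodeLower i.2) 1 2

lemma abs_lossGap_one_le {d₀ n m : ℕ} (φ : Vec d₀ → Vec d₀ → Vec 1) (γ : ℝ)
    (A : Set (Vec d₀)) (D : Fin n → Transition d₀) (D' : Fin m → Transition d₀) {K : ℝ}
    (h : ∀ i, ∃ w ∈ nodeBox i, |lossGap φ γ A D D' w.1 w.2| ≤ K)
    {v : Vec 1} (hv : ‖v‖ ≤ 1) : |lossGap φ γ A D D' v 1| ≤ 486 * K := by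
  have hv' : |v 0| ≤ 1 := (PiLp.norm_apply_le v 0).trans hv
  rw [abs_le] at hv'
  rcases le_total 0 (v 0) with h0 | h0
  · refine abs_lossGap_one_le_of_nonneg φ γ A D D' (fun i => ?_) ⟨h0, hv'.2⟩
    obtain ⟨w, hw, hK⟩ := h (true, i)
    exact ⟨w.1, w.2, by simpa using hw.1 0, hw.2, hK⟩
  -- Negating both the features and the weight changes no predictor and makes the weight
  -- nonnegative.
  · rw [← lossGap_neg_neg]
    refine abs_lossGap_one_le_of_nonneg _ γ A D D' (fun i => ?_)
      ⟨by simpa using h0, by simp only [PiLp.neg_apply]; linarith⟩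
    obtain ⟨w, hw, hK⟩ := h (false, i)
    refine ⟨-w.1, w.2, ?_, hw.2, by rwa [lossGap_neg_neg]⟩
    have := hw.1 0
    simp only [Bool.false_eq_true, if_false, Set.mem_Icc] at this
    simp only [PiLp.neg_apply, Set.mem_Icc]
    constructor <;> linarith


/-! ### The grid for dimension at least two -/

lemma exists_fin_mem_cell {M : ℕ} (hM : 0 < M) {t : ℝ} (ht : |t| ≤ 1) :
    ∃ c : Fin M, t ∈ Set.Icc (-1 + 2 / M * (c : ℝ)) (-1 + 2 / M * (c : ℝ) + 2 / M) := by
  have hM' : (0 : ℝ) < M := by exact_mod_cast hM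
  rw [abs_le] at ht
  have h0 : 0 ≤ (t + 1) * M / 2 := by
    have : 0 ≤ t + 1 := by linarith
    positivity
  rcases lt_or_ge t 1 with h1 | h1
  · refine ⟨⟨⌊(t + 1) * M / 2⌋₊, ?_⟩, ?_⟩
    · rw [Nat.floor_lt h0]
      nlinarith
    · have h2 := Nat.floor_le h0
      have h3 := Nat.lt_floor_add_one ((t + 1) * M / 2)
      simp only
      set c : ℝ := (⌊(t + 1) * M / 2⌋₊ : ℝ)
      have h4 : 2 / M * ((t + 1) * M / 2) = t + 1 := by field_simp
      have h5 : (0 : ℝ) ≤ 2 / M := by positivity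
      have h6 := mul_le_mul_of_nonneg_left h2 h5
      have h7 := mul_le_mul_of_nonneg_left h3.le h5
      constructor <;> nlinarith
  -- At the right end the floor would be the invalid index `M`; the last cell contains this point.
  · obtain rfl : t = 1 := le_antisymm ht.2 h1
    refine ⟨⟨M - 1, by omega⟩, ?_⟩
    have h2 : ((M - 1 : ℕ) : ℝ) = M - 1 := by rw [Nat.cast_sub hM]; simp
    simp only [h2]
    have h3 : (2 : ℝ) / M * (M - 1) = 2 - 2 / M := by field_simp
    rw [h3]
    have h5 : (0 : ℝ) ≤ 2 / M := by positivity
    constructor <;> linarith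

/-- The sharp factor is `√d`; the cruder `d` is affordable because the sample bound absorbs powers
of `d`. -/
lemma norm_le_card_mul {d : ℕ} (hd : 0 < d) (x : Vec d) {s : ℝ} (hs : 0 ≤ s)
    (h : ∀ i, |x i| ≤ s) : ‖x‖ ≤ d * s := by
  have hd' : (1 : ℝ) ≤ d := by exact_mod_cast hd
  refine abs_le_of_sq_le_sq' ?_ (by positivity) |>.2
  rw [EuclideanSpace.norm_sq_eq]
  calc ∑ i, ‖x i‖ ^ 2 ≤ ∑ _i : Fin d, s ^ 2 :=
        Finset.sum_le_sum fun i _ => pow_le_pow_left₀ (norm_nonneg _) (h i) 2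
    _ = d * s ^ 2 := by simp
    _ ≤ (d * s) ^ 2 := by
      rw [mul_pow]
      exact mul_le_mul_of_nonneg_right (le_self_pow₀ hd' two_ne_zero) (sq_nonneg s)

/-- The cells of the grid of side `2 / M` on `[-1, 1]^d`, with `lam` in `[1, 1 + 2 / M]`. -/
noncomputable def gridBox {d : ℕ} (M : ℕ) (c : Fin d → Fin M) : Set (Vec d × ℝ) :=
  sampleBox (fun i => -1 + 2 / M * (c i : ℝ)) (fun i => -1 + 2 / M * (c i : ℝ) + 2 / M)
    1 (1 + 2 / M)

lemma exists_gridBox_near {d M : ℕ} (hd : 0 < d) (hM : 0 < M) {v : Vec d} (hv : ‖v‖ ≤ 1) :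
    ∃ c : Fin d → Fin M, ∀ w ∈ gridBox M c,
      ‖v - w.1‖ ≤ d * (2 / M) ∧ |1 - w.2| ≤ d * (2 / M) := by
  have hs : (0 : ℝ) ≤ 2 / M := by positivity
  have hd' : (1 : ℝ) ≤ d := by exact_mod_cast hd
  choose c hc using fun i : Fin d =>
    exists_fin_mem_cell hM ((PiLp.norm_apply_le v i).trans hv)
  refine ⟨c, fun w hw => ⟨norm_le_card_mul hd _ hs fun i => ?_, ?_⟩⟩
  · have h1 := hc i
    have h2 := hw.1 i
    simp only [Set.mem_Icc] at h1 h2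
    rw [PiLp.sub_apply, abs_le]
    constructor <;> linarith
  · have h2 := hw.2
    simp only [Set.mem_Icc] at h2
    rw [abs_le]
    constructor <;> nlinarith

/-! ### Counting samples -/

/-- The growth of the number of samples is absorbed by `x ^ (c₁ d log d)` once `d ≥ 2`. -/
lemma pow_le_rpow_mul_log {d a : ℕ} {K x : ℝ} (hd : 2 ≤ d) (hx : 2 ≤ x) (hK : 1 ≤ K)
    (hKa : K ≤ 2 ^ a) :
    (K * d * x) ^ (2 * d + 2) ≤ x ^ ((6 * a + 12 : ℝ) * (d * Real.log d)) := by
  have hd' : (2 : ℝ) ≤ d := by exact_mod_cast hd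
  have hx0 : 0 < x := by linarith
  have hx1 : 1 ≤ x := by linarith
  have hl2 : (1 : ℝ) / 2 ≤ Real.log 2 := by linarith [Real.log_two_gt_d9]
  have hld : (1 : ℝ) / 2 ≤ Real.log d := hl2.trans (Real.log_le_log (by norm_num) hd')
  have hlx : (1 : ℝ) / 2 ≤ Real.log x := hl2.trans (Real.log_le_log (by norm_num) hx)
  -- Each factor of the base becomes a power of `x` with exponent a multiple of `log d`, using `log
  -- x ≥ 1 / 2` here and `log d ≥ 1 / 2` below.
  have hdx : (d : ℝ) ≤ x ^ (2 * Real.log d) := by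
    rw [Real.rpow_def_of_pos hx0]
    calc (d : ℝ) = Real.exp (Real.log d) := (Real.exp_log (by linarith)).symm
      _ ≤ _ := by gcongr; nlinarith
  have hKx : K ≤ x ^ (2 * a * Real.log d) := by
    calc K ≤ 2 ^ a := hKa
      _ ≤ x ^ a := by gcongr
      _ = x ^ (a : ℝ) := (Real.rpow_natCast x a).symm
      _ ≤ _ := by
        refine Real.rpow_le_rpow_of_exponent_le hx1 ?_
        nlinarith [(Nat.cast_nonneg a : (0 : ℝ) ≤ a)]
  have hxx : x ≤ x ^ (2 * Real.log d) := by
    conv_lhs => rw [← Real.rpow_one x]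
    exact Real.rpow_le_rpow_of_exponent_le hx1 (by linarith)
  have hbase : K * d * x ≤ x ^ ((2 * a + 4) * Real.log d) := by
    calc K * d * x ≤ x ^ (2 * a * Real.log d) * x ^ (2 * Real.log d) * x ^ (2 * Real.log d) := by
          gcongr
      _ = _ := by
          rw [← Real.rpow_add hx0, ← Real.rpow_add hx0]
          ring_nf
  have hge : 1 ≤ K * d * x := by
    have : 1 ≤ K * d := by nlinarith
    nlinarith
  calc (K * d * x) ^ (2 * d + 2) ≤ (K * d * x) ^ (3 * d) := pow_le_pow_right₀ hge (by omega)
    _ ≤ (x ^ ((2 * a + 4) * Real.log d)) ^ (3 * d) := by gcongr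
    _ = _ := by
      rw [← Real.rpow_natCast, ← Real.rpow_mul hx0.le]
      congr 1
      push_cast
      ring

/-- For `p ≥ 1` the factor with `p` and the two logarithms is at least `log 2 ≥ 1 / 2`; nothing more
of it is needed. -/
lemma le_sampleBound {c₁ c₂ ν B₀ L B Rmax δ : ℝ} {d p : ℕ} (hc₂ : 0 ≤ c₂) (hp : p ≠ 0) :
    (max 2 (1 / ν)) ^ (c₁ * (d * Real.log d)) * (c₂ / 2) * Real.log (max 2 (1 / δ))
      ≤ sampleBound c₁ c₂ d p ν B₀ L B Rmax δ := by
  have hl : ∀ y : ℝ, (1 : ℝ) / 2 ≤ Real.log (max 2 y) := fun y => by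
    have := Real.log_le_log (by norm_num) (le_max_left 2 y)
    linarith [Real.log_two_gt_d9]
  have hp' : (1 : ℝ) ≤ p := by exact_mod_cast Nat.one_le_iff_ne_zero.2 hp
  have h1 : 0 ≤ Real.log (max 1 (B₀ * L / (B + Rmax))) := Real.log_nonneg (le_max_left _ _)
  have h2 := hl (1 / ν)
  have h3 := hl (1 / δ)
  unfold sampleBound
  rw [mul_assoc]
  have h4 : (1 : ℝ) / 2 ≤
      p * (Real.log (max 2 (1 / ν)) + Real.log (max 1 (B₀ * L / (B + Rmax)))) := by nlinarith
  gcongr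
  · calc c₂ / 2 = c₂ * (1 / 2) := by ring
      _ ≤ _ := by gcongr

lemma inv_max_le_sqrt {ν : ℝ} (hν : 0 < ν) : 1 / max 2 (1 / ν) ≤ √ν := by
  have h0 : (0 : ℝ) < max 2 (1 / ν) := lt_of_lt_of_le two_pos (le_max_left _ _)
  refine Real.le_sqrt_of_sq_le ?_
  have h1 : 1 / max 2 (1 / ν) ≤ ν := by
    rw [div_le_iff₀ h0]
    have := mul_le_mul_of_nonneg_left (le_max_right 2 (1 / ν)) hν.le
    rwa [mul_one_div_cancel hν.ne'] at this
  have h2 : 1 / max 2 (1 / ν) ≤ 1 := by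
    rw [div_le_iff₀ h0]; linarith [le_max_left 2 (1 / ν)]
  have h3 : 0 ≤ 1 / max 2 (1 / ν) := by positivity
  nlinarith

lemma bellmanErr_le_of_abs_lossGap_le {d₀ d n m : ℕ} {φ : Vec d₀ → Vec d₀ → Vec d} {γ : ℝ}
    {A : Set (Vec d₀)} {D : Fin n → Transition d₀} {D' : Fin m → Transition d₀} {v : Vec d}
    {Δ : ℝ} (hΔ : 0 ≤ Δ) (h : |lossGap φ γ A D D' v 1| ≤ √Δ) :
    bellmanErr γ A D D' (linPred φ v) ≤ Δ := by
  rw [bellmanErr_linPred, ← sq_abs, ← Real.sq_sqrt hΔ]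
  gcongr

end OfflineRL

/-! ### The main theorem -/

theorem theorem3 :
    -- absolute constants
    ∃ c₁ c₂ c₃ : ℝ, 0 < c₁ ∧ 0 < c₂ ∧ 0 < c₃ ∧
    ∀ (d₀ d : ℕ) (_ : 0 < d)
      (B₀ B Rmax L γ : ℝ) (_ : 0 ≤ B₀) (_ : 0 ≤ B) (_ : 0 ≤ Rmax) (_ : 0 < B + Rmax)
      (_ : 0 ≤ L) (_ : 0 ≤ γ) (_ : γ ≤ 1)
      -- states, actions, feature map
      (S A : Set (OfflineRL.Vec d₀))
      (_ : S ⊆ Metric.closedBall 0 B₀) (_ : A ⊆ Metric.closedBall 0 B₀)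
      (φ : OfflineRL.Vec d₀ → OfflineRL.Vec d₀ → OfflineRL.Vec d)
      (_ : OfflineRL.FeatureBounded φ B₀ B) (_ : OfflineRL.FeatureLipschitz φ B₀ L)
      -- the pseudo-dimension
      (p : ℕ) (_ : OfflineRL.pseudoDim (OfflineRL.singlePointClass φ γ A B₀ Rmax) = p)
      -- the training dataset
      (n : ℕ) (_ : 0 < n) (Dtrain : Fin n → OfflineRL.Transition d₀)
      (_ : ∀ i, (Dtrain i).MemTrain S A Rmax)
      (Δ δ : ℝ) (_ : 0 < Δ) (_ : 0 < δ)
      (k : ℕ) (_ : OfflineRL.sampleBound c₁ c₂ d p (Δ / (B + Rmax) ^ 4) B₀ L B Rmax δ ≤ k),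
      -- an event of probability at least `1 - δ` on which the guarantee holds
      ∃ E : Set (Fin k → OfflineRL.Vec d × ℝ), MeasurableSet E ∧
        ENNReal.ofReal (1 - δ) ≤ OfflineRL.iidH d k E ∧
        ∀ ω ∈ E, ∀ (m : ℕ) (_ : 0 < m) (Dsyn : Fin m → OfflineRL.Transition d₀)
          (_ : ∀ i, (Dsyn i).MemSyn B₀ Rmax),
          ∑ j, OfflineRL.modBellmanErr γ A Dtrain Dsyn
              (OfflineRL.linPred φ (ω j).1) (ω j).2 ≤ Δ / c₃ →
            ∀ f ∈ OfflineRL.Q₀ φ, OfflineRL.bellmanErr γ A Dtrain Dsyn f ≤ Δ := by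
  open OfflineRL in
  obtain ⟨c, hc, hc1, hbox⟩ := exists_le_H_sampleBox
  obtain ⟨a, ha⟩ := pow_unbounded_of_one_lt (97 / c) (one_lt_two : (1 : ℝ) < 2)
  have hK : 1 ≤ 97 / c := by rw [le_div_iff₀ hc]; linarith
  -- In `c₂`, the outer `2` cancels the half in `le_sampleBound`, the `1` serves `d ≥ 2`, and `12 /
  -- (c * (1 / 2)) ^ 2` serves six boxes of side at least `1 / 2` when `d = 1`. The value of `c₃` is
  -- the square of the interpolation constant.
  refine ⟨6 * a + 12, 2 * (1 + 12 / (c * (1 / 2)) ^ 2), 486 ^ 2, by positivity, by positivity,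
    by positivity, ?_⟩
  intro d₀ d hd B₀ B Rmax L γ _ hB hR hBR _ hγ hγ1 S A hS hA φ hφ _ p hp n hn Dtrain hDt Δ δ hΔ hδ
    k hk
  have hDt' : ∀ i, (Dtrain i).MemSyn B₀ Rmax := fun i =>
    ⟨by simpa using hS (hDt i).1, by simpa using hA (hDt i).2.1, (hDt i).2.2.1,
      by simpa using hS (hDt i).2.2.2⟩
  have hne : A.Nonempty := ⟨_, (hDt ⟨0, hn⟩).2.1⟩
  rcases eq_or_ne p 0 with rfl | hp0
  · refine ⟨Set.univ, MeasurableSet.univ, ?_, fun ω _ m _ Dsyn hDs _ f hf => ?_⟩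
    · rw [measure_univ]
      exact ENNReal.ofReal_le_one.2 (by linarith)
    · obtain ⟨v, hv, rfl⟩ := hf
      have hz : ∀ z : Transition d₀, z.MemSyn B₀ Rmax → residual φ γ A v 1 z = 0 := fun z hz =>
        residual_eq_zero_of_pseudoDim_eq_zero (by simpa using hp) hv hz
      refine bellmanErr_le_of_abs_lossGap_le hΔ.le ?_
      simp [lossGap, modBellmanLoss_linPred, hz _ (hDt' _), hz _ (hDs _)]
  have hk' := (le_sampleBound (by positivity) hp0).trans hk
  rw [mul_div_cancel_left₀ _ two_ne_zero] at hk'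
  have hlog : 0 ≤ Real.log (max 2 (1 / δ)) :=
    Real.log_nonneg (one_le_two.trans (le_max_left _ _))
  rcases (show d = 1 ∨ 2 ≤ d by omega) with rfl | hd2
  · obtain ⟨E, hE, hPE, hhit⟩ := exists_event_forall_hit (H 1) nodeBox
      (fun i => measurableSet_sampleBox _ _ _ _) (q := (c * (1 / 2)) ^ 2) (by positivity)
      (fun i => by
        refine hbox 1 _ _ 1 2 (1 / 2) (by norm_num) ?_ ?_ (by norm_num) (by norm_num) ?_
          (by norm_num) <;>
        · obtain ⟨b, i⟩ := i
          intro _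
          cases b <;> fin_cases i <;> norm_num [nodeLower, nodeUpper])
      hδ k (by
        refine le_trans ?_ hk'
        simp only [Fintype.card_prod, Fintype.card_bool, Fintype.card_fin, Nat.cast_one,
          Real.log_one, mul_zero, Real.rpow_zero, one_mul]
        gcongr
        norm_num)
    refine ⟨E, hE, hPE, fun ω hω m hm Dsyn _ hsum f hf => ?_⟩
    obtain ⟨v, hv, rfl⟩ := hf
    refine bellmanErr_le_of_abs_lossGap_le hΔ.le ?_
    have := abs_lossGap_one_le φ γ A Dtrain Dsyn (fun i => by
      obtain ⟨j, hj⟩ := hhit ω hω i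
      exact ⟨ω j, hj, abs_lossGap_le (by norm_num) hsum j⟩) hv
    linarith
  · set ν := Δ / (B + Rmax) ^ 4 with hν
    have hν0 : 0 < ν := by positivity
    set x := max 2 (1 / ν) with hx
    have hx2 : 2 ≤ x := le_max_left _ _
    have hd' : (2 : ℝ) ≤ d := by exact_mod_cast hd2
    -- With this `M`, cells put a sample within `d * (2 / M) ≤ 1 / (48 * x) ≤ √ν / 48` of `(v, 1)`,
    -- and the Lipschitz constant `24 * (B + Rmax) ^ 2` turns this into `√Δ / 2`.
    set M := ⌈96 * d * x⌉₊ with hM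
    have hdx : 1 ≤ d * x := by nlinarith
    have hMl : 96 * d * x ≤ M := Nat.le_ceil _
    have hMu : (M : ℝ) ≤ 97 * d * x := by
      have := (Nat.ceil_lt_add_one (by positivity : 0 ≤ 96 * d * x)).le
      linarith
    have hMr : (0 : ℝ) < M := by nlinarith
    have hM0 : 0 < M := by exact_mod_cast hMr
    have : Nonempty (Fin M) := ⟨⟨0, hM0⟩⟩
    have hM1 : (2 : ℝ) / M ≤ 1 := by rw [div_le_iff₀ hMr]; nlinarith
    have hM2 : (0 : ℝ) ≤ 2 / M := by positivity
    obtain ⟨E, hE, hPE, hhit⟩ := exists_event_forall_hit (H d) (gridBox (d := d) M)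
      (fun i => measurableSet_sampleBox _ _ _ _) (q := (c * (2 / M)) ^ (d + 1)) (by positivity)
      (fun i => by
        have hi : ∀ j, (2 : ℝ) / M * (i j : ℝ) ≤ 2 := fun j => by
          have : ((i j : ℕ) : ℝ) ≤ M := by exact_mod_cast (i j).2.le
          calc (2 : ℝ) / M * (i j : ℝ) ≤ 2 / M * M := by gcongr
            _ = 2 := by field_simp
        have hi0 : ∀ j, (0 : ℝ) ≤ 2 / M * (i j : ℝ) := fun j => by positivity
        exact hbox d _ _ 1 _ (2 / M) hM2 (fun j => by linarith [hi0 j])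
          (fun j => by linarith [hi j]) (by norm_num) (by linarith) (fun j => le_rfl) le_rfl)
      hδ k (by
        refine le_trans ?_ hk'
        gcongr
        have hcount := pow_le_rpow_mul_log hd2 hx2 hK ha.le
        have h0 : (0 : ℝ) ≤ 97 / c * d * x := by positivity
        have h1 : (M : ℝ) ≤ 97 / c * d * x := by
          refine hMu.trans ?_
          gcongr
          rw [le_div_iff₀ hc]; linarith
        have h2 : (c * (2 / M) : ℝ)⁻¹ ≤ 97 / c * d * x := by
          calc (c * (2 / M) : ℝ)⁻¹ = 1 / c * (M / 2) := by field_simp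
            _ ≤ 1 / c * (97 * d * x) := by gcongr; linarith
            _ = _ := by ring
        have h3 : (2 : ℝ) ≤ 97 / c * d * x := by nlinarith
        simp only [Fintype.card_fun, Fintype.card_fin, Nat.cast_pow]
        -- The numbers `2`, `M` and `(c * (2 / M))⁻¹` are all at most `97 / c * d * x`, and occur `1
        -- + d + (d + 1) = 2 * d + 2` times in total.
        calc 2 * (M : ℝ) ^ d / (c * (2 / M)) ^ (d + 1)
            = 2 * (M : ℝ) ^ d * ((c * (2 / M))⁻¹) ^ (d + 1) := by rw [inv_pow, div_eq_mul_inv]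
          _ ≤ (97 / c * d * x) * (97 / c * d * x) ^ d * (97 / c * d * x) ^ (d + 1) := by gcongr
          _ = (97 / c * d * x) ^ (2 * d + 2) := by ring
          _ ≤ _ := hcount
          _ ≤ _ := le_mul_of_one_le_right (by positivity) (by
            have : 0 ≤ 12 / (c * (1 / 2)) ^ 2 := by positivity
            linarith))
    refine ⟨E, hE, hPE, fun ω hω m hm Dsyn hDs hsum f hf => ?_⟩
    obtain ⟨v, hv, rfl⟩ := hf
    refine bellmanErr_le_of_abs_lossGap_le hΔ.le ?_
    obtain ⟨i, hi⟩ := exists_gridBox_near hd hM0 hv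
    obtain ⟨j, hj⟩ := hhit ω hω i
    obtain ⟨hj1, hj2⟩ := hi _ hj
    have hs : (d : ℝ) * (2 / M) ≤ 1 / x / 48 := by
      rw [div_div, ← mul_div_assoc, div_le_div_iff₀ hMr (by positivity)]
      linarith
    have hs1 : (d : ℝ) * (2 / M) ≤ 1 := by
      refine hs.trans ?_
      have : 1 / x ≤ 1 := by rw [div_le_iff₀ (by linarith)]; linarith
      linarith
    have h1 := abs_lossGap_sub_le hγ hγ1 hB hR hA hne hφ hn hm hDt' hDs hv hs1 hj1 hj2
    have h2 := abs_lossGap_le (by norm_num) hsum j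
    have h3 : √Δ = √ν * (B + Rmax) ^ 2 := by
      have : Δ = ν * ((B + Rmax) ^ 2) ^ 2 := by rw [hν]; field_simp
      rw [this, Real.sqrt_mul hν0.le, Real.sqrt_sq (by positivity)]
    have h4 : 24 * (B + Rmax) ^ 2 * (d * (2 / M)) ≤ √Δ / 2 := by
      calc 24 * (B + Rmax) ^ 2 * (d * (2 / M)) ≤ 24 * (B + Rmax) ^ 2 * (√ν / 48) := by
            gcongr
            exact hs.trans (by gcongr; exact inv_max_le_sqrt hν0)
        _ = √Δ / 2 := by rw [h3]; ring
    -- The gap at `(v, 1)` is at most `√Δ / 486` from the sample plus `√Δ / 2` from the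
    -- displacement.
    have h5 := abs_sub_abs_le_abs_sub (lossGap φ γ A Dtrain Dsyn v 1)
      (lossGap φ γ A Dtrain Dsyn (ω j).1 (ω j).2)
    have h6 := Real.sqrt_nonneg Δ
    linarith
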